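/- Let $\log$ denote the logarithm to base $2$. For every integer $d\ge 2$ and every real $\varepsilon>0$ there exist a constant $C_d<\frac12+\varepsilon$ and a threshold $t_0=t_0(d,\varepsilon)$ such that for every integer $t\ge t_0$ there is a family of $t$ $d$-tuples of finite sets $(A_i^1,A_i^2,\dots,A_i^d)$, $1\le i\le t$, with the property that, for all $i,i'\in\{1,\dots,t\}$ and $j,j'\in\{1,\dots,d\}$, $$A_i^j\cap A_{i'}^{j'}=\emptyset\quad\text{if and only if}\quad i=i'\text{ and }j\ne j',$$ and $$\sum_{i=1}^{t}\sum_{j=1}^{d}|A_i^j|\le C_d\,d\,t\log t .$$ Consequently the following conjecture of Davoodi, Javadi and Omoomi is false: there exist a function $f$ and a constant $c>0$ such that, whenever $d\ge2$, $t\ge f(d)$ and $(A_i^1,\dots,A_i^d)$, $1\le i\le t$, is a family of $t$ $d$-tuples of finite sets with the above property, one has $\sum_{i,j}|A_i^j|\ge c\,d^2\,t\log t$. -/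

import Mathlib

/-- A family of `t` many `d`-tuples of finite sets, `A i j` being the `j`-th set of the `i`-th
tuple, in which two sets are disjoint if and only if they are at different positions of the same
tuple. (For `i = i'` and `j = j'` the condition says that `A i j` is nonempty.) -/
def IsDisjointExactlyWithin {α : Type*} {t d : ℕ} (A : Fin t → Fin d → Finset α) : Prop :=
  ∀ (i i' : Fin t) (j j' : Fin d), Disjoint (A i j) (A i' j') ↔ i = i' ∧ j ≠ j'

/-- The sum of the sizes of all sets of the family. -/
def totalSize {α : Type*} {t d : ℕ} (A : Fin t → Fin d → Finset α) : ℕ :=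
  ∑ i, ∑ j, (A i j).card

/-- The conjecture of Davoodi, Javadi and Omoomi: up to a positive absolute constant, the total
size of such a family is at least `d ^ 2 * t * log t` once `t` is large in terms of `d`. -/
def DavoodiJavadiOmoomiConjecture : Prop :=
  ∃ (f : ℕ → ℕ) (c : ℝ), 0 < c ∧
    ∀ d t : ℕ, 2 ≤ d → f d ≤ t →
      ∀ (α : Type) (A : Fin t → Fin d → Finset α), IsDisjointExactlyWithin A →
        c * (d : ℝ) ^ 2 * (t : ℝ) * Real.logb 2 (t : ℝ) ≤ (totalSize A : ℝ)

open Finset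

/-! Read a tuple as a word over `Fin d` whose letter classes are its sets. It then suffices to find
crossing codes with about `4 ^ a` words, the Sperner rate; cost is about `a` per set, with log₂ of
the code size near `2 * a`. For one ordered pair of letters, merging them splits the balanced words
into fibres of size at least `q.centralBinom`, and distinct words in a fibre realise the pair. All
pairs are handled at almost no extra cost by `chainDiff`: the values `f (w k) - g (w (k - 1))` along
a sequence force `f` to agree at the first discrepancy and `g` at the last, so both maps separate,
for `r + 1` group elements instead of `r`. Induction over the pairs and pigeonhole give the code. -/

/-- The consecutive differences of `f` and `g` along a finite sequence, with both ends kept. -/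
def chainDiff {V G : Type*} [AddGroup G] (f g : V → G) {r : ℕ} (w : Fin r → V) : Fin (r + 1) → G :=
  fun i => (Fin.snoc (fun k => f (w k)) 0 : Fin (r + 1) → G) i -
    (Fin.cons 0 (fun k => g (w k)) : Fin (r + 1) → G) i

/-- At the first place where two sequences with the same differences differ, `f` agrees. -/
lemma exists_ne_left_of_chainDiff_eq {V G : Type*} [AddGroup G] (f g : V → G) {r : ℕ}
    {w w' : Fin r → V} (h : chainDiff f g w = chainDiff f g w') (hne : w ≠ w') :
    ∃ k, w k ≠ w' k ∧ f (w k) = f (w' k) := by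
  classical
  obtain ⟨k₀, hk₀⟩ := Function.ne_iff.mp hne
  have hs : (univ.filter fun k => w k ≠ w' k).Nonempty := ⟨k₀, by simpa using hk₀⟩
  set k := (univ.filter fun k => w k ≠ w' k).min' hs
  refine ⟨k, by simpa using min'_mem _ hs, ?_⟩
  have hlt : ∀ l, l < k → w l = w' l := fun l hl => by
    by_contra hc
    exact absurd (min'_le _ l (by simpa using hc)) (not_le.mpr hl)
  have hc : (Fin.cons 0 (fun k => g (w k)) : Fin (r + 1) → G) k.castSucc =
      (Fin.cons 0 (fun k => g (w' k)) : Fin (r + 1) → G) k.castSucc := by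
    rcases Fin.eq_zero_or_eq_succ k.castSucc with h0 | ⟨l, hl⟩
    · rw [h0]; simp
    · rw [hl]
      have : l < k := by
        have := congrArg Fin.val hl
        simp at this
        exact Fin.lt_def.mpr (by omega)
      simp [hlt l this]
  have := congrFun h k.castSucc
  simp only [chainDiff, Fin.snoc_castSucc] at this
  rw [hc] at this
  exact sub_left_injective this

/-- At the last place where two sequences with the same differences differ, `g` agrees. -/
lemma exists_ne_right_of_chainDiff_eq {V G : Type*} [AddGroup G] (f g : V → G) {r : ℕ}
    {w w' : Fin r → V} (h : chainDiff f g w = chainDiff f g w') (hne : w ≠ w') :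
    ∃ k, w k ≠ w' k ∧ g (w k) = g (w' k) := by
  classical
  obtain ⟨k₀, hk₀⟩ := Function.ne_iff.mp hne
  have hs : (univ.filter fun k => w k ≠ w' k).Nonempty := ⟨k₀, by simpa using hk₀⟩
  set k := (univ.filter fun k => w k ≠ w' k).max' hs
  refine ⟨k, by simpa using max'_mem _ hs, ?_⟩
  have hlt : ∀ l, k < l → w l = w' l := fun l hl => by
    by_contra hc
    exact absurd (le_max' _ l (by simpa using hc)) (not_le.mpr hl)
  have hc : (Fin.snoc (fun k => f (w k)) 0 : Fin (r + 1) → G) k.succ =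
      (Fin.snoc (fun k => f (w' k)) 0 : Fin (r + 1) → G) k.succ := by
    rcases Fin.eq_castSucc_or_eq_last k.succ with ⟨l, hl⟩ | h0
    · rw [hl]
      have : k < l := by
        have := congrArg Fin.val hl
        simp at this
        exact Fin.lt_def.mpr (by omega)
      simp [hlt l this]
    · rw [h0]; simp
  have := congrFun h k.succ
  simp only [chainDiff, Fin.cons_succ] at this
  rw [hc] at this
  exact sub_right_injective this

/-- If each relation `sep e` separates distinct points in the fibres of some map with about `exp h`
values, then on a power of `W` one map with about `exp h` values per coordinate has fibres in which
every `sep e` separates distinct points in some coordinate. -/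
lemma exists_simultaneously_separating_map {W E : Type} [Nonempty W]
    (sep : E → W → W → Prop) {h : ℝ} (hh : 0 ≤ h) (S : Finset E)
    (hS : ∀ e ∈ S, ∃ (Z : Type) (_ : Fintype Z) (f : W → Z), Real.log (Fintype.card Z) ≤ h ∧
      ∀ w w', f w = f w' → w ≠ w' → sep e w w') :
    ∀ δ : ℝ, 0 < δ → ∃ (I : Type) (_ : Fintype I) (_ : Nonempty I) (Z : Type) (_ : Fintype Z)
      (F : (I → W) → Z), Real.log (Fintype.card Z) ≤ (1 + δ) * Fintype.card I * h ∧
      ∀ w w', F w = F w' → w ≠ w' → ∀ e ∈ S, ∃ k, sep e (w k) (w' k) := by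
  classical
  induction S using Finset.induction_on with
  | empty =>
    intro δ hδ
    refine ⟨Unit, inferInstance, inferInstance, Unit, inferInstance, fun _ => (), ?_, by simp⟩
    simp
    positivity
  | insert e S he ih =>
    intro δ hδ
    obtain ⟨I, _, _, Z, _, F, hZ, hF⟩ := ih (fun e he => hS e (mem_insert_of_mem he)) (δ / 2)
      (by positivity)
    obtain ⟨Y, _, f, hY, hf⟩ := hS e (mem_insert_self _ _)
    have : Nonempty Z := Nonempty.map F inferInstance
    have : Nonempty Y := Nonempty.map f inferInstance
    have hIpos : (0 : ℝ) < Fintype.card I := by exact_mod_cast Fintype.card_pos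
    -- Both value sets embed in `ZMod L`, where they can be subtracted; the maximum keeps `log L`
    -- within the inductive bound.
    set L := max (Fintype.card Z) (Fintype.card (I → Y)) with hL
    have hLpos : 0 < L := lt_max_of_lt_left Fintype.card_pos
    have : NeZero L := ⟨hLpos.ne'⟩
    obtain ⟨a⟩ : Nonempty (Z ↪ ZMod L) := Function.Embedding.nonempty_of_card_le (by
      rw [ZMod.card]; exact le_max_left _ _)
    obtain ⟨b⟩ : Nonempty ((I → Y) ↪ ZMod L) := Function.Embedding.nonempty_of_card_le (by
      rw [ZMod.card]; exact le_max_right _ _)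
    have hlogL : Real.log L ≤ (1 + δ / 2) * Fintype.card I * h := by
      rcases max_choice (Fintype.card Z) (Fintype.card (I → Y)) with hc | hc
      · rw [hL, hc]; exact hZ
      · rw [hL, hc, Fintype.card_fun, Nat.cast_pow, Real.log_pow]
        have : (Fintype.card I : ℝ) * Real.log (Fintype.card Y) ≤ Fintype.card I * h :=
          mul_le_mul_of_nonneg_left hY hIpos.le
        nlinarith [mul_nonneg hIpos.le hh]
    -- Large enough that `(r + 1) * (1 + δ / 2) ≤ (1 + δ) * r`.
    obtain ⟨r, hr⟩ := exists_nat_gt ((1 + δ / 2) / (δ / 2))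
    have hr0 : (0 : ℝ) < r := lt_trans (by positivity) hr
    have hr' : 0 < r := by exact_mod_cast hr0
    rw [div_lt_iff₀ (by positivity)] at hr
    refine ⟨Fin r × I, inferInstance, ⟨⟨⟨0, hr'⟩, Classical.arbitrary I⟩⟩, Fin (r + 1) → ZMod L,
      inferInstance, fun w => chainDiff (fun v : I → W => a (F v))
        (fun v => b (fun i => f (v i))) (fun k i => w (k, i)), ?_, ?_⟩
    · rw [Fintype.card_fun, ZMod.card, Nat.cast_pow, Real.log_pow, Fintype.card_fin,
        Fintype.card_prod, Fintype.card_fin]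
      push_cast
      calc ((r : ℝ) + 1) * Real.log L ≤ (r + 1) * ((1 + δ / 2) * Fintype.card I * h) := by gcongr
        _ = ((r + 1) * (1 + δ / 2)) * (Fintype.card I * h) := by ring
        _ ≤ ((1 + δ) * r) * (Fintype.card I * h) := by
          apply mul_le_mul_of_nonneg_right _ (by positivity)
          nlinarith
        _ = _ := by ring
    · intro w w' heq hne
      have hne' : (fun (k : Fin r) (i : I) => w (k, i)) ≠ fun k i => w' (k, i) := fun hc =>
        hne (funext fun ⟨k, i⟩ => congrFun (congrFun hc k) i)
      intro e' he'
      rcases mem_insert.mp he' with rfl | he'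
      · obtain ⟨k, hk, hk'⟩ := exists_ne_right_of_chainDiff_eq _ _ heq hne'
        obtain ⟨i, hi⟩ := Function.ne_iff.mp hk
        exact ⟨(k, i), hf _ _ (congrFun (b.injective hk') i) hi⟩
      · obtain ⟨k, hk, hk'⟩ := exists_ne_left_of_chainDiff_eq _ _ heq hne'
        obtain ⟨i, hi⟩ := hF _ _ (a.injective hk') hk e' he'
        exact ⟨(k, i), hi⟩

/-! ### Crossing codes from balanced words -/

/-- `C` is a set of words over `Fin d` in which every letter occurs exactly `a` times and such that
two distinct words realise all ordered pairs of distinct letters. -/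
def IsCrossingCode {X : Type} [Fintype X] {d : ℕ} (a : ℕ) (C : Finset (X → Fin d)) : Prop :=
  (∀ w ∈ C, ∀ j, #{x | w x = j} = a) ∧
    ∀ w ∈ C, ∀ w' ∈ C, w ≠ w' → ∀ j j', j ≠ j' → ∃ x, w x = j ∧ w' x = j'

/-- Words of length `d * q` in which every letter occurs `q` times. -/
abbrev BalancedWord (d q : ℕ) : Type :=
  {w : Fin d × Fin q → Fin d // ∀ j, #{x | w x = j} = q}

instance (d q : ℕ) : Nonempty (BalancedWord d q) := by
  refine ⟨⟨Prod.fst, fun j => ?_⟩⟩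
  have : (univ.filter fun x : Fin d × Fin q => x.1 = j) = {j} ×ˢ univ := by
    ext x
    simp only [mem_filter, mem_univ, true_and, mem_product, mem_singleton, and_true]
  rw [this]; simp

/-- Replace the letter `j'` by `j`. -/
def mergeLetters {X : Type} {d : ℕ} (j j' : Fin d) (w : X → Fin d) : X → Fin d :=
  fun x => if w x = j' then j else w x

/-- Sperner's argument: if the pair is missed, one `j`-class contains the other; having equal size
they coincide, and so do the words. -/
lemma exists_pair_of_mergeLetters_eq {X : Type} [Fintype X] {d q : ℕ} {j j' : Fin d} (hj : j ≠ j')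
    {w w' : X → Fin d} (hw : ∀ j, #{x | w x = j} = q) (hw' : ∀ j, #{x | w' x = j} = q)
    (h : mergeLetters j j' w = mergeLetters j j' w') (hne : w ≠ w') :
    ∃ x, w x = j ∧ w' x = j' := by
  by_contra! hc
  have hsub : (univ.filter fun x => w x = j) ⊆ univ.filter fun x => w' x = j := by
    intro x hx
    simp only [mem_filter, mem_univ, true_and] at hx ⊢
    have h1 := congrFun h x
    have h2 := hc x hx
    simp only [mergeLetters] at h1
    grind
  have heq := eq_of_subset_of_card_le hsub (by rw [hw, hw'])
  apply hne
  funext x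
  have h1 := congrFun h x
  have h2 := Finset.ext_iff.mp heq x
  simp only [mergeLetters, mem_filter, mem_univ, true_and] at h1 h2
  grind

/-- The `2 * q` positions carrying `j` or `j'` can be redistributed by choosing any `q` of them for
`j`. -/
lemma centralBinom_le_card_fiber_mergeLetters {d q : ℕ} {j j' : Fin d} (hj : j ≠ j')
    (w : BalancedWord d q) :
    q.centralBinom ≤ #{v : BalancedWord d q | mergeLetters j j' v.1 = mergeLetters j j' w.1} := by
  classical
  set U : Finset (Fin d × Fin q) := {x | w.1 x = j ∨ w.1 x = j'} with hU
  have hUcard : #U = 2 * q := by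
    rw [hU, filter_or, card_union_of_disjoint, w.2, w.2, two_mul]
    rw [disjoint_filter]
    rintro x - h1 h2
    exact hj (h1.symm.trans h2)
  rw [Nat.centralBinom, ← hUcard, ← card_powersetCard]
  let v (B : Finset (Fin d × Fin q)) : Fin d × Fin q → Fin d :=
    fun x => if x ∈ B then j else if x ∈ U then j' else w.1 x
  have hv : ∀ B ∈ powersetCard q U, ∀ i, #{x | v B x = i} = q := by
    intro B hB i
    obtain ⟨hBU, hBq⟩ := mem_powersetCard.mp hB
    by_cases hi : i = j
    · have : (univ.filter fun x => v B x = i) = B := by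
        ext x
        simp only [v, mem_filter, mem_univ, true_and, hU]
        grind
      rw [this, hBq]
    by_cases hi' : i = j'
    · have : (univ.filter fun x => v B x = i) = U \ B := by
        ext x
        simp only [v, mem_filter, mem_univ, true_and, mem_sdiff, hU]
        grind
      rw [this, card_sdiff_of_subset hBU, hUcard, hBq]
      omega
    · refine Eq.trans (congrArg card ?_) (w.2 i)
      ext x
      have := @hBU x
      simp only [v, mem_filter, mem_univ, true_and, hU] at this ⊢
      grind
  refine card_le_card_of_injOn (fun B => if hB : B ∈ powersetCard q U then ⟨v B, hv B hB⟩ else w)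
    ?_ ?_
  · intro B hB
    have hB' : B ∈ powersetCard q U := hB
    simp only [hB', dif_pos, coe_filter, mem_univ, true_and, Set.mem_ofPred_eq]
    funext x
    have := (mem_powersetCard.mp hB').1
    have := @this x
    simp only [mergeLetters, v, hU, mem_filter, mem_univ, true_and] at this ⊢
    grind
  · intro B hB B' hB' heq
    have hB1 : B ∈ powersetCard q U := hB
    have hB2 : B' ∈ powersetCard q U := hB'
    simp only [hB1, hB2, dif_pos, Subtype.mk.injEq] at heq
    ext x
    have := congrFun heq x
    have h1 := (mem_powersetCard.mp hB1).1
    have h2 := (mem_powersetCard.mp hB2).1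
    have h1 := @h1 x
    have h2 := @h2 x
    simp only [v] at this
    grind

lemma log_card_range_mergeLetters_le {d q : ℕ} {j j' : Fin d} (hj : j ≠ j') :
    Real.log (Fintype.card (Set.range fun w : BalancedWord d q => mergeLetters j j' w.1)) ≤
      Real.log (Fintype.card (BalancedWord d q)) - Real.log q.centralBinom := by
  classical
  have h1 := mul_card_image_le_card (s := (univ : Finset (BalancedWord d q)))
    (f := fun w => mergeLetters j j' w.1) (n := q.centralBinom) (by
      intro b hb
      obtain ⟨w, -, rfl⟩ := mem_image.mp hb
      exact centralBinom_le_card_fiber_mergeLetters hj w)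
  have h2 : Fintype.card (Set.range fun w : BalancedWord d q => mergeLetters j j' w.1) =
      #(univ.image fun w : BalancedWord d q => mergeLetters j j' w.1) := by
    rw [← Set.toFinset_card, Set.toFinset_range]
  have h3 : 0 < #(univ.image fun w : BalancedWord d q => mergeLetters j j' w.1) :=
    card_pos.mpr (univ_nonempty.image _)
  have h4 := q.centralBinom_pos
  rw [h2, le_sub_iff_add_le, add_comm, ← Real.log_mul (by positivity) (by positivity)]
  apply Real.log_le_log (by positivity)
  rw [card_univ] at h1
  exact_mod_cast h1

/-- There are crossing codes of rate arbitrarily close to that of Sperner families. -/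
lemma exists_crossingCode {d : ℕ} (hd : 2 ≤ d) {η : ℝ} (hη : 0 < η) :
    ∃ (X : Type) (_ : Fintype X) (a : ℕ) (C : Finset (X → Fin d)), 0 < a ∧ IsCrossingCode a C ∧
      (1 - η) * a * Real.log 4 ≤ Real.log #C := by
  classical
  have hlog4 : 0 < Real.log 4 := Real.log_pos (by norm_num)
  have hlogd : 0 < Real.log d := Real.log_pos (by exact_mod_cast hd)
  -- Half of the loss `η` pays for the factor `2 * q` in `4 ^ q ≤ 2 * q * q.centralBinom`.
  obtain ⟨q, hq0, hq⟩ : ∃ q : ℕ, 0 < q ∧ Real.log (2 * q) ≤ η / 2 * q * Real.log 4 := by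
    have h1 : Filter.Tendsto (fun q : ℕ => 2 * (q : ℝ)) Filter.atTop Filter.atTop :=
      tendsto_natCast_atTop_atTop.const_mul_atTop (by norm_num)
    have h2 := h1.eventually (Real.isLittleO_log_id_atTop.bound
      (show 0 < η / 4 * Real.log 4 by positivity))
    obtain ⟨q, hq, hq'⟩ := (h2.and (Filter.eventually_gt_atTop 0)).exists
    refine ⟨q, hq', (le_abs_self _).trans ?_⟩
    simp only [id, Real.norm_eq_abs] at hq
    rw [abs_of_nonneg (show (0 : ℝ) ≤ 2 * q by positivity)] at hq
    linarith
  set K := Real.log q.centralBinom with hK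
  have hKq : q * Real.log 4 - η / 2 * q * Real.log 4 ≤ K := by
    have h1 : (4 : ℝ) ^ q ≤ 2 * q * q.centralBinom := by
      exact_mod_cast Nat.four_pow_le_two_mul_self_mul_centralBinom q hq0
    have h2 := Real.log_le_log (by positivity) h1
    have h3 := q.centralBinom_pos
    rw [Real.log_pow, Real.log_mul (by positivity) (by positivity)] at h2
    linarith
  set H := Real.log (Fintype.card (BalancedWord d q)) with hH
  have hHle : H ≤ d * q * Real.log d := by
    have h1 : Fintype.card (BalancedWord d q) ≤ d ^ (d * q) := by
      refine (Fintype.card_subtype_le _).trans ?_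
      simp
    have h2 : (0 : ℝ) < Fintype.card (BalancedWord d q) := by exact_mod_cast Fintype.card_pos
    have h3 : (Fintype.card (BalancedWord d q) : ℝ) ≤ (d : ℝ) ^ (d * q) := by exact_mod_cast h1
    have h4 := Real.log_le_log h2 h3
    rw [Real.log_pow] at h4
    exact_mod_cast h4
  have hK0 : 0 ≤ K := Real.log_natCast_nonneg _
  have hhnn : 0 ≤ H - K := by
    have j0 : (⟨0, by omega⟩ : Fin d) ≠ ⟨1, by omega⟩ := by simp
    exact (Real.log_natCast_nonneg _).trans (log_card_range_mergeLetters_le (q := q) j0)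
  -- The other half of `η`: since `H ≤ d * q * log d`, the excess `δ * (H - K)` is at most `η / 2 *
  -- q * log 4`.
  set δ := η / 2 * Real.log 4 / (d * Real.log d) with hδ
  have hd0 : (0 : ℝ) < d := by positivity
  have hδ0 : 0 < δ := by positivity
  obtain ⟨I, _, _, Z, _, F, hZ, hF⟩ := exists_simultaneously_separating_map
    (W := BalancedWord d q) (E := Fin d × Fin d)
    (fun e w w' => ∃ x, w.1 x = e.1 ∧ w'.1 x = e.2) hhnn (univ.filter fun e => e.1 ≠ e.2) (by
      intro e he
      simp only [mem_filter, mem_univ, true_and] at he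
      refine ⟨Set.range fun w : BalancedWord d q => mergeLetters e.1 e.2 w.1, inferInstance,
        Set.rangeFactorization _, log_card_range_mergeLetters_le he, fun w w' h hne => ?_⟩
      exact exists_pair_of_mergeLetters_eq he w.2 w'.2 (congrArg Subtype.val h)
        (fun hc => hne (Subtype.ext hc))) δ hδ0
  have hI : (0 : ℝ) < Fintype.card I := by exact_mod_cast Fintype.card_pos
  have : Nonempty Z := Nonempty.map F inferInstance
  have hZpos : (0 : ℝ) < Fintype.card Z := by exact_mod_cast Fintype.card_pos
  have hWpos : (0 : ℝ) < Fintype.card (I → BalancedWord d q) := by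
    exact_mod_cast Fintype.card_pos
  obtain ⟨z, hz⟩ := Fintype.exists_le_card_fiber_of_nsmul_le_card F
    (b := (Fintype.card (I → BalancedWord d q) : ℝ) / Fintype.card Z) (by
      rw [nsmul_eq_mul, mul_div_cancel₀ _ hZpos.ne'])
  let u : (I → BalancedWord d q) → (I × (Fin d × Fin q) → Fin d) := fun w x => (w x.1).1 x.2
  have hu : Function.Injective u := fun w w' h =>
    funext fun i => Subtype.ext (funext fun x => congrFun h (i, x))
  refine ⟨I × (Fin d × Fin q), inferInstance, Fintype.card I * q,
    (univ.filter fun w => F w = z).image u, Nat.mul_pos Fintype.card_pos hq0, ⟨?_, ?_⟩, ?_⟩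
  · intro w hw j
    obtain ⟨w, -, rfl⟩ := mem_image.mp hw
    rw [card_filter, Fintype.sum_prod_type]
    have hcount : ∀ i, ∑ x, (if u w (i, x) = j then 1 else 0) = q := fun i => by
      rw [← card_filter]; exact (w i).2 j
    simp only [hcount]
    simp
  · intro w hw w' hw' hne j j' hj
    obtain ⟨w, hwz, rfl⟩ := mem_image.mp hw
    obtain ⟨w', hwz', rfl⟩ := mem_image.mp hw'
    have hz' : F w = F w' := (mem_filter.mp hwz).2.trans (mem_filter.mp hwz').2.symm
    obtain ⟨i, x, hx⟩ := hF w w' hz' (fun hc => hne (congrArg u hc)) (j, j')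
      (by simpa using hj)
    exact ⟨(i, x), hx⟩
  · rw [card_image_of_injective _ hu]
    refine le_trans ?_ (Real.log_le_log (by positivity) hz)
    rw [Real.log_div hWpos.ne' hZpos.ne', Fintype.card_fun, Nat.cast_pow, Real.log_pow, ← hH]
    have h1 : δ * (H - K) ≤ η / 2 * q * Real.log 4 := by
      calc δ * (H - K) ≤ δ * (d * q * Real.log d) := by gcongr; linarith
        _ = _ := by rw [hδ]; field_simp
    have h2 : (1 - η) * q * Real.log 4 ≤ H - (1 + δ) * (H - K) := by linarith
    have h3 := mul_le_mul_of_nonneg_left h2 hI.le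
    push_cast
    linarith

/-! ### From codes to families of sets -/

/-- Concatenating words of a crossing code gives a crossing code. -/
lemma IsCrossingCode.exists_pow {X : Type} [Fintype X] {d a : ℕ} {C : Finset (X → Fin d)}
    (hC : IsCrossingCode a C) (r : ℕ) :
    ∃ C' : Finset (Fin r × X → Fin d), IsCrossingCode (r * a) C' ∧ #C' = #C ^ r := by
  classical
  let u : (Fin r → C) → (Fin r × X → Fin d) := fun w x => (w x.1).1 x.2
  have hu : Function.Injective u := fun w w' h =>
    funext fun i => Subtype.ext (funext fun x => congrFun h (i, x))
  refine ⟨univ.image u, ⟨?_, ?_⟩, ?_⟩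
  · intro w hw j
    obtain ⟨w, -, rfl⟩ := mem_image.mp hw
    rw [card_filter, Fintype.sum_prod_type]
    simp_rw [u, ← card_filter, hC.1 _ (w _).2 j]
    simp
  · intro w hw w' hw' hne j j' hj
    obtain ⟨w, -, rfl⟩ := mem_image.mp hw
    obtain ⟨w', -, rfl⟩ := mem_image.mp hw'
    obtain ⟨i, hi⟩ := Function.ne_iff.mp fun hc => hne (congrArg u hc)
    obtain ⟨x, hx⟩ := hC.2 _ (w i).2 _ (w' i).2 (fun hc => hi (Subtype.ext hc)) j j' hj
    exact ⟨(i, x), hx⟩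
  · rw [card_image_of_injective _ hu, card_univ]
    simp

/-- The letter classes of the words of a crossing code, each marked with its letter. -/
lemma IsCrossingCode.exists_family {X : Type} [Fintype X] {d a t : ℕ} {C : Finset (X → Fin d)}
    (hC : IsCrossingCode a C) (ht : t ≤ #C) :
    ∃ A : Fin t → Fin d → Finset ℕ, IsDisjointExactlyWithin A ∧
      totalSize A = t * (d * (a + 1)) := by
  classical
  obtain ⟨s⟩ : Nonempty (Fin t ↪ C) := Function.Embedding.nonempty_of_card_le (by simpa using ht)
  let b : X ⊕ Fin d ↪ ℕ := (Fintype.equivFin _).toEmbedding.trans Fin.valEmbedding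
  -- The marker `j` makes sets with the same letter meet, at the cost of one element each.
  refine ⟨fun i j => ((univ.filter fun x => (s i).1 x = j).disjSum {j}).map b, ?_, ?_⟩
  · intro i i' j j'
    rw [disjoint_map, Finset.disjoint_left]
    constructor
    · intro h
      have hj : j ≠ j' := fun hj => h (a := Sum.inr j) (by simp) (by simp [hj])
      refine ⟨?_, hj⟩
      by_contra hi
      obtain ⟨x, hx, hx'⟩ := hC.2 _ (s i).2 _ (s i').2
        (fun hc => hi (s.injective (Subtype.ext hc))) j j' hj
      exact h (a := Sum.inl x) (by simpa using hx) (by simpa using hx')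
    · rintro ⟨rfl, hj⟩ (x | x) hx hx'
      · simp only [inl_mem_disjSum, mem_filter, mem_univ, true_and] at hx hx'
        exact hj (hx.symm.trans hx')
      · simp only [inr_mem_disjSum, mem_singleton] at hx hx'
        exact hj (hx.symm.trans hx')
  · simp only [totalSize, card_map, card_disjSum, card_singleton, hC.1 _ (s _).2]
    simp

lemma exists_small_family {d : ℕ} (hd : 2 ≤ d) {ε : ℝ} (hε : 0 < ε) :
    ∃ t₀ : ℕ, ∀ t : ℕ, t₀ ≤ t → ∃ A : Fin t → Fin d → Finset ℕ, IsDisjointExactlyWithin A ∧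
      (totalSize A : ℝ) ≤ (1 / 2 + ε) * d * t * Real.logb 2 t := by
  have hlog2 : 0 < Real.log 2 := Real.log_pos (by norm_num)
  have hlog4 : Real.log 4 = 2 * Real.log 2 := by
    rw [show (4 : ℝ) = 2 ^ 2 by norm_num, Real.log_pow]; norm_num
  -- This turns the rate into `a ≤ (1 + ε) / 2 * log₂ #C`; the remaining `ε / 2` absorbs the `a + 1`
  -- due to rounding `r` up and to the marker.
  set η := ε / (1 + ε) with hη
  have hη0 : 0 < η := by positivity
  have hη1 : 1 - η = 1 / (1 + ε) := by rw [hη]; field_simp; ring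
  obtain ⟨X, _, a, C, ha, hC, hlog⟩ := exists_crossingCode hd hη0
  have ha' : (0 : ℝ) < a := by exact_mod_cast ha
  rw [hη1, hlog4] at hlog
  have hlog' : a * (2 * Real.log 2) ≤ (1 + ε) * Real.log #C := by
    have := mul_le_mul_of_nonneg_left hlog (show 0 ≤ 1 + ε by positivity)
    calc _ = (1 + ε) * (1 / (1 + ε) * a * (2 * Real.log 2)) := by field_simp
      _ ≤ _ := this
  have hCpos : 0 < Real.log #C := lt_of_lt_of_le (by positivity) hlog
  have hC1 : 1 < #C := by
    by_contra hc
    have : #C = 0 ∨ #C = 1 := by omega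
    rcases this with h | h <;> simp [h] at hCpos
  have htend : Filter.Tendsto (fun t : ℕ => Real.logb 2 t) Filter.atTop Filter.atTop :=
    (Real.tendsto_logb_atTop (by norm_num)).comp tendsto_natCast_atTop_atTop
  obtain ⟨t₀, ht₀⟩ := Filter.eventually_atTop.mp
    ((htend.eventually_ge_atTop ((a + 1) / (ε / 2))).and (Filter.eventually_gt_atTop 0))
  refine ⟨t₀, fun t ht => ?_⟩
  obtain ⟨hbig, htpos⟩ := ht₀ t ht
  have htR : (0 : ℝ) < t := by exact_mod_cast htpos
  rw [div_le_iff₀ (by positivity)] at hbig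
  set r := Nat.clog #C t with hr
  obtain ⟨C', hC', hcard⟩ := hC.exists_pow r
  obtain ⟨A, hA, hsize⟩ := hC'.exists_family (t := t) (by
    rw [hcard]; exact Nat.le_pow_clog hC1 t)
  refine ⟨A, hA, ?_⟩
  have hrle : ((r : ℝ) - 1) * Real.log #C ≤ Real.log t := by
    rcases Nat.lt_or_ge 1 t with h1 | h1
    · have h2 := Nat.pow_pred_clog_lt_self hC1 h1
      have h3 : 0 < r := Nat.clog_pos hC1 h1
      have h4 : (#C : ℝ) ^ (r - 1) ≤ t := by exact_mod_cast h2.le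
      have h5 := Real.log_le_log (by positivity) h4
      rw [Real.log_pow, Nat.cast_sub h3] at h5
      simpa using h5
    · have : t = 1 := by omega
      have hr0 : r = 0 := by rw [hr, this]; simp
      rw [hr0, this]
      simp
      exact hCpos.le
  have hlogt : Real.log t = Real.logb 2 t * Real.log 2 := by
    rw [Real.logb, div_mul_cancel₀ _ hlog2.ne']
  have hra : ((r : ℝ) - 1) * a ≤ (1 + ε) / 2 * Real.logb 2 t := by
    rcases le_or_gt ((r : ℝ) - 1) 0 with h | h
    · have h0 : 0 ≤ Real.logb 2 t := Real.logb_nonneg (by norm_num) (by exact_mod_cast htpos)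
      exact (mul_nonpos_of_nonpos_of_nonneg h ha'.le).trans (by positivity)
    · have h1 := mul_le_mul_of_nonneg_left hlog' h.le
      have h2 := mul_le_mul_of_nonneg_left hrle (show 0 ≤ 1 + ε by positivity)
      rw [hlogt] at h2
      have h3 : (((r : ℝ) - 1) * a) * (2 * Real.log 2) ≤
          ((1 + ε) / 2 * Real.logb 2 t) * (2 * Real.log 2) := by linarith
      exact le_of_mul_le_mul_right h3 (by positivity)
  have hfin : (r : ℝ) * a + 1 ≤ (1 / 2 + ε) * Real.logb 2 t := by linarith
  rw [hsize]
  push_cast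
  calc (t : ℝ) * (d * (r * a + 1)) ≤ t * (d * ((1 / 2 + ε) * Real.logb 2 t)) := by gcongr
    _ = _ := by ring

theorem theorem2 :
    (∀ d : ℕ, 2 ≤ d → ∀ ε : ℝ, 0 < ε →
      ∃ C : ℝ, C < 1 / 2 + ε ∧
        ∃ t₀ : ℕ, ∀ t : ℕ, t₀ ≤ t →
          ∃ A : Fin t → Fin d → Finset ℕ, IsDisjointExactlyWithin A ∧
            (totalSize A : ℝ) ≤ C * (d : ℝ) * (t : ℝ) * Real.logb 2 (t : ℝ)) ∧
    ¬ DavoodiJavadiOmoomiConjecture := by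
  refine ⟨fun d hd ε hε => ⟨1 / 2 + ε / 2, by linarith,
    exists_small_family hd (by positivity)⟩, ?_⟩
  rintro ⟨f, c, hc, hconj⟩
  -- With `d > 1 / c`, the bound `d * t * log₂ t` (from `ε = 1 / 2`) is below the conjectured one.
  obtain ⟨n, hn⟩ := exists_nat_gt (1 / c)
  set d := max n 2 with hd
  obtain ⟨t₀, ht₀⟩ := exists_small_family (d := d) (le_max_right _ _) (ε := 1 / 2) (by norm_num)
  set t := max (max t₀ (f d)) 2 with ht
  obtain ⟨A, hA, hsize⟩ := ht₀ t (by omega)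
  have h1 := (hconj d t (le_max_right _ _) (by omega) ℕ A hA).trans hsize
  have ht1 : (1 : ℝ) < t := by exact_mod_cast (show 1 < t by omega)
  have hlog : 0 < Real.logb 2 t := Real.logb_pos (by norm_num) ht1
  have hd0 : (0 : ℝ) < d := by exact_mod_cast (show 0 < d by omega)
  have hnd : (n : ℝ) ≤ d := by exact_mod_cast le_max_left n 2
  have hcd : 1 < c * d := by
    rw [div_lt_iff₀ hc] at hn
    nlinarith
  have hpos : 0 < (d : ℝ) * t * Real.logb 2 t := by positivity
  nlinarith [mul_lt_mul_of_pos_right hcd hpos]
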